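/- **Setting.** Let $\mathcal X$ be a compact space and $\mathcal Y\subseteq[0,1]$. Let $P_{tr},P_{te}$ be probability measures on $\mathcal X$ (the training and test laws of the covariate), with a common conditional law $P(dy\mid x)$ of the label on $\mathcal Y$. Assume that the density $\beta=dP_{te}/dP_{tr}$ exists and satisfies $\beta\le B$. Let $\mathcal H$ be a reproducing kernel Hilbert space on $\mathcal X$ with canonical feature map $\Phi:\mathcal X\to\mathcal H$ and $\|\Phi(x)\|\le R$ for all $x$, and let $\Upsilon$ be a map from $\mathcal X\times\mathcal Y$ to a Hilbert space with $\|\Upsilon(x,y)\|\le R$ for all $(x,y)$ ($\Phi$ and $\Upsilon$ strongly measurable). Let $\mathcal D$ be a compact subset of a finite-dimensional normed space, $l'(x,y;\theta)$ a loss, and $l(x;\theta)=\mathbb E[l'(x,Y;\theta)\mid x]$. Assume that there are a constant $C$ and a function $f(x;\theta)$ such that for every $\theta\in\mathcal D$ there are vectors $u_\theta\in\mathcal H$ and $\Lambda_\theta$ in the Hilbert space of $\Upsilon$, of norm at most $C$, with $$l(x;\theta)=\langle\Phi(x),u_\theta\rangle+f(x;\theta),\qquad l'(x,y;\theta)=\langle\Upsilon(x,y),\Lambda_\theta\rangle+f(x;\theta)$$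 for all $x,y$. Assume that on $\mathcal D\times\mathcal X$ the function $l$ is continuous, bounded in absolute value by a constant $D$, and $L$-Lipschitz in $\theta$ uniformly over $x$. Let $\theta^\star$ minimize $\mathbb E[l'(X_{te},Y_{te};\theta)]$ over $\mathcal D$, where $X_{te}\sim P_{te}$ and $Y_{te}\mid X_{te}\sim P(dy\mid X_{te})$. Fix $\rho\in[0,1]$. **Estimator.** Draw an i.i.d. labelled training sample $(x_j^{tr},y_j^{tr})_{j\le n_{tr}}$ with $x_j^{tr}\sim P_{tr}$ and $y_j^{tr}\mid x_j^{tr}\sim P(dy\mid x_j^{tr})$ and, independently, an i.i.d. sample $(x_i^{te})_{i\le n_{te}}$ from $P_{te}$, where $n_{te}\ge1$ and $m=\lfloor\rho n_{tr}\rfloor\ge1$. Let $\hat\beta$ be a measurable function of $(x_j^{tr})_{j\le m}$ and $(x_i^{te})_{i\le n_{te}}$ that minimizes $$\Big\|\tfrac1m\sum_{j=1}^m\hat\beta_j\Phi(x_j^{tr})-\tfrac1{n_{te}}\sum_{i=1}^{n_{te}}\Phi(x_i^{te})\Big\|_{\mathcal H}^2\quad\text{subject to } 0\le\hat\beta_j\le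 B .$$ Let $\hat l$ be determined by the remaining training data $(x_j^{tr},y_j^{tr})_{m<j\le n_{tr}}$ and be such that for every $\theta\in\mathcal D$ there is $\hat u_\theta\in\mathcal H$ with $\|\hat u_\theta\|\le C$ and $\hat l(x;\theta)=\langle\Phi(x),\hat u_\theta\rangle+f(x;\theta)$ for all $x$. Put $$V_R(\theta)=\frac1m\sum_{j=1}^m\hat\beta_j\big(l'(x_j^{tr},y_j^{tr};\theta)-\hat l(x_j^{tr};\theta)\big)+\frac1{n_{te}}\sum_{i=1}^{n_{te}}\hat l(x_i^{te};\theta),$$ and let $\hat\theta_R\in\mathcal D$ minimize $V_R$ over $\mathcal D$ (almost surely). **Theorem.** Then $$\mathbb E[l'(X_{te},Y_{te};\hat\theta_R)]\le\mathbb E[l'(X_{te},Y_{te};\theta^\star)]+\mathcal O\big(n_{tr}^{-1/2}+n_{te}^{-1/2}\big),$$ where the expectations are over a fresh test pair $(X_{te},Y_{te})$, both with high probability and in expectation over the data: for every $\delta\in(0,1)$ there is a constant $M_\delta$ such that with probability at least $1-\delta$ the excess risk $\mathbb E[l'(X_{te},Y_{te};\hat\theta_R)]-\mathbb E[l'(X_{te},Y_{te};\theta^\star)]$,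 as a function of the data, is at most $M_\delta(n_{tr}^{-1/2}+n_{te}^{-1/2})$; and there is a constant $M'$ such that the expectation of the excess risk over the data is at most $M'(n_{tr}^{-1/2}+n_{te}^{-1/2})$. The constants do not depend on $n_{tr}$, $n_{te}$, $\hat\beta$, $\hat l$ or $\hat\theta_R$. -/

import Mathlib

open MeasureTheory ProbabilityTheory
open scoped RealInnerProductSpace

noncomputable section

/-- The canonical feature map `Φ(x) = K(·, x)` of a real reproducing kernel Hilbert space `H` of
functions on `X`. It satisfies `K(x, x') = ⟪Φ x, Φ x'⟫` and `h x = ⟪h, Φ x⟫` for `h : H`. -/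
def featureMap {X : Type*} (H : Type*) [NormedAddCommGroup H] [InnerProductSpace ℝ H]
    [CompleteSpace H] [RKHS ℝ H X ℝ] (x : X) : H :=
  RKHS.kerFun H x (1 : ℝ)

/-- The expected loss given the covariate, `l(x; θ) = E[l'(x, Y; θ) | x]`, where `κ` is the
conditional distribution of the label given the covariate. -/
def condLoss {X Y E : Type*} [MeasurableSpace X] [MeasurableSpace Y]
    (κ : Kernel X Y) (loss : X → Y → E → ℝ) (x : X) (θ : E) : ℝ :=
  ∫ y, loss x y θ ∂(κ x)

/-- The risk `E[l'(X, Y; θ)]` when `X` has law `P` and `Y` given `X = x` has law `κ x`. -/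
def risk {X Y E : Type*} [MeasurableSpace X] [MeasurableSpace Y]
    (P : Measure X) (κ : Kernel X Y) (loss : X → Y → E → ℝ) (θ : E) : ℝ :=
  ∫ z, loss z.1 z.2 θ ∂(P ⊗ₘ κ)

/-- The kernel mean matching objective
`‖(1/m) ∑ⱼ bⱼ Φ(xⱼ) - (1/n) ∑ᵢ Φ(x'ᵢ)‖²` for training covariates `x` and test covariates `x'`. -/
def kmmObjective {X : Type*} (H : Type*) [NormedAddCommGroup H] [InnerProductSpace ℝ H]
    [CompleteSpace H] [RKHS ℝ H X ℝ] {m n : ℕ} (x : Fin m → X) (x' : Fin n → X)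
    (b : Fin m → ℝ) : ℝ :=
  ‖(1 / (m : ℝ)) • ∑ j, b j • featureMap H (x j)
      - (1 / (n : ℝ)) • ∑ i, featureMap H (x' i)‖ ^ 2

/-- `b` is a solution of the kernel mean matching quadratic program: it minimizes the objective
over all weight vectors with entries in `[0, B]`. -/
def IsKMMWeights {X : Type*} (H : Type*) [NormedAddCommGroup H] [InnerProductSpace ℝ H]
    [CompleteSpace H] [RKHS ℝ H X ℝ] {m n : ℕ} (B : ℝ) (x : Fin m → X) (x' : Fin n → X)
    (b : Fin m → ℝ) : Prop :=
  (∀ j, b j ∈ Set.Icc 0 B) ∧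
    ∀ b' : Fin m → ℝ, (∀ j, b' j ∈ Set.Icc 0 B) →
      kmmObjective H x x' b ≤ kmmObjective H x x' b'

/-- The number `⌊ρ n⌋` of training points that are used for kernel mean matching. -/
def splitSize (ρ : ℝ) (n : ℕ) : ℕ := ⌊ρ * n⌋₊

theorem splitSize_le {ρ : ℝ} (hρ : ρ ∈ Set.Icc (0 : ℝ) 1) (n : ℕ) : splitSize ρ n ≤ n :=
  Nat.floor_le_of_le (mul_le_of_le_one_left (Nat.cast_nonneg n) hρ.2)

/-- The first `m` of `n` data points. -/
def firstPart {Z : Type*} {m n : ℕ} (h : m ≤ n) (S : Fin n → Z) : Fin m → Z :=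
  fun j => S (Fin.castLE h j)

/-- The data points after the first `m` of `n` data points. -/
def lastPart {Z : Type*} {n : ℕ} (m : ℕ) (S : Fin n → Z) : Fin (n - m) → Z :=
  fun j => S ⟨m + j, by omega⟩

/-- The law of the data: `ntr` labelled training points that are i.i.d. from `Ptr ⊗ₘ κ` and,
independently of them, `nte` unlabelled test points that are i.i.d. from `Pte`. -/
def dataLaw {X Y : Type*} [MeasurableSpace X] [MeasurableSpace Y]
    (Ptr Pte : Measure X) [IsProbabilityMeasure Ptr] [IsProbabilityMeasure Pte]
    (κ : Kernel X Y) [IsMarkovKernel κ] (ntr nte : ℕ) :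
    Measure ((Fin ntr → X × Y) × (Fin nte → X)) :=
  (Measure.pi fun _ : Fin ntr => Ptr ⊗ₘ κ).prod (Measure.pi fun _ : Fin nte => Pte)

/-- The robust reweighted empirical risk
`V_R(θ) = (1/m) ∑ⱼ bⱼ (l'(xⱼ, yⱼ; θ) - lhat(xⱼ; θ)) + (1/n) ∑ᵢ lhat(x'ᵢ; θ)`
for labelled points `z = (x, y)`, unlabelled points `x'`, weights `b` and control variate
`lhat`. -/
def robustRisk {X Y E : Type*} {m n : ℕ} (loss : X → Y → E → ℝ) (lhat : X → E → ℝ)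
    (b : Fin m → ℝ) (z : Fin m → X × Y) (x' : Fin n → X) (θ : E) : ℝ :=
  (1 / (m : ℝ)) * ∑ j, b j * (loss (z j).1 (z j).2 θ - lhat (z j).1 θ)
    + (1 / (n : ℝ)) * ∑ i, lhat (x' i) θ

end

/-! Up to one random quantity, `robustRisk` is the test-sample mean of the conditional loss `l`.
Since `f` cancels in `l - lhat`, the difference is exactly `⟪noise, Λ⟫ + ⟪residual, u - uhat⟫`: the
noise is the weighted mean of the centred features `Υ - E[Υ | x]`, and the residual is the kernel
mean matching error (`abs_robustRisk_sub_le`). By Cauchy–Schwarz this is small uniformly in `θ`, and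
`lhat` matters only through `‖uhat‖ ≤ C`, however it depends on the data.

The weights see covariates but not labels, so the noise terms are orthogonal and their mean has size
`m ^ (-1/2)` (`integral_norm_weighted_noise_le`). The true density is an admissible weight, so the
residual is at most the sum of two i.i.d. Hilbert-space fluctuations
(`IsKMMWeights.norm_residual_le`, `integral_norm_mean_iid_le`). The test-sample mean of `l` is
uniformly close to its expectation, up to a shift independent of `θ`, by chaining
(`exists_empirical_process_bound`).

Comparing `V_R` at its minimizer and at `θstar` gives an integrable bound on the excess risk;
Markov's inequality turns its expectation into a tail bound. -/

open scoped NNReal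

/-! ### Orthogonality and second moments of averages -/

/-- An integrable function on a product space has integral zero if its integral over one
coordinate vanishes. -/
theorem integral_pi_eq_zero_of_integral_update_eq_zero {Z : Type*} [MeasurableSpace Z]
    {ν : Measure Z} [IsProbabilityMeasure ν] {n : ℕ} (j : Fin n) {G : (Fin n → Z) → ℝ}
    (hG : Integrable G (Measure.pi fun _ : Fin n => ν))
    (h : ∀ S, ∫ z, G (Function.update S j z) ∂ν = 0) :
    ∫ S, G S ∂(Measure.pi fun _ : Fin n => ν) = 0 := by
  obtain _ | n := n
  · exact j.elim0
  have mp := (measurePreserving_piFinSuccAbove (fun _ : Fin (n + 1) => ν) j).symm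
  rw [← mp.integral_comp' (g := G), integral_prod_symm]
  · obtain ⟨z₀⟩ : Nonempty Z := nonempty_of_isProbabilityMeasure ν
    refine integral_eq_zero_of_ae (ae_of_all _ fun s => ?_)
    rw [Pi.zero_apply, ← h (Fin.insertNth j z₀ s)]
    refine integral_congr_ae (ae_of_all _ fun z => ?_)
    simp [MeasurableEquiv.piFinSuccAbove, Fin.insertNthEquiv, Fin.update_insertNth]
  · exact mp.integrable_comp_of_integrable hG

/-- The version of `integral_pi_eq_zero_of_integral_update_eq_zero` with an additional
independent variable. -/
theorem integral_pi_prod_eq_zero_of_integral_update_eq_zero {Z T : Type*} [MeasurableSpace Z]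
    [MeasurableSpace T] {ν : Measure Z} [IsProbabilityMeasure ν] {τ : Measure T}
    [IsProbabilityMeasure τ] {n : ℕ} (j : Fin n) {G : (Fin n → Z) × T → ℝ}
    (hG : Integrable G ((Measure.pi fun _ : Fin n => ν).prod τ))
    (h : ∀ S t, ∫ z, G (Function.update S j z, t) ∂ν = 0) :
    ∫ p, G p ∂((Measure.pi fun _ : Fin n => ν).prod τ) = 0 := by
  rw [integral_prod_symm _ hG]
  refine integral_eq_zero_of_ae ?_
  filter_upwards [hG.prod_left_ae] with t ht
  exact integral_pi_eq_zero_of_integral_update_eq_zero j ht fun S => h S t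

/-- The mean of `m` orthogonal random vectors that are bounded by `K` has expected norm at most
`K / √m`. -/
theorem integral_norm_mean_le_of_orthogonal {Ω F : Type*} [MeasurableSpace Ω]
    [NormedAddCommGroup F] [InnerProductSpace ℝ F] {P : Measure Ω} [IsProbabilityMeasure P]
    {m : ℕ} {K : ℝ} (hK : 0 ≤ K) {ζ : Fin m → Ω → F}
    (hζ : ∀ j, StronglyMeasurable (ζ j)) (hb : ∀ j ω, ‖ζ j ω‖ ≤ K)
    (ho : ∀ j k, j ≠ k → ∫ ω, ⟪ζ j ω, ζ k ω⟫ ∂P = 0) :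
    Integrable (fun ω => ‖(1 / (m : ℝ)) • ∑ j, ζ j ω‖) P ∧
      ∫ ω, ‖(1 / (m : ℝ)) • ∑ j, ζ j ω‖ ∂P ≤ K / √m := by
  have hint : ∀ j k, Integrable (fun ω => ⟪ζ j ω, ζ k ω⟫) P := fun j k =>
    Integrable.of_bound ((hζ j).inner (hζ k)).aestronglyMeasurable (K * K)
      (ae_of_all _ fun ω => (norm_inner_le_norm _ _).trans
        (mul_le_mul (hb j ω) (hb k ω) (norm_nonneg _) hK))
  have hsm : StronglyMeasurable fun ω => (1 / (m : ℝ)) • ∑ j, ζ j ω :=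
    (Finset.stronglyMeasurable_fun_sum _ fun j _ => hζ j).const_smul _
  have hLp : MemLp (fun ω => ‖(1 / (m : ℝ)) • ∑ j, ζ j ω‖) 2 P := by
    refine MemLp.of_bound hsm.norm.aestronglyMeasurable (‖1 / (m : ℝ)‖ * ∑ _j : Fin m, K)
      (ae_of_all _ fun ω => ?_)
    rw [norm_norm, norm_smul]
    gcongr
    exact norm_sum_le_of_le _ fun j _ => hb j ω
  refine ⟨hLp.integrable one_le_two, ?_⟩
  have hsq : ∫ ω, ‖(1 / (m : ℝ)) • ∑ j, ζ j ω‖ ^ 2 ∂P ≤ K ^ 2 / m := by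
    have h1 : ∀ ω, ‖(1 / (m : ℝ)) • ∑ j, ζ j ω‖ ^ 2
        = (1 / (m : ℝ)) ^ 2 * ∑ j, ∑ k, ⟪ζ j ω, ζ k ω⟫ := fun ω => by
      rw [norm_smul, mul_pow, Real.norm_eq_abs, sq_abs, ← real_inner_self_eq_norm_sq, sum_inner]
      simp_rw [inner_sum]
    have h2 : ∀ j, ∑ k, ∫ ω, ⟪ζ j ω, ζ k ω⟫ ∂P ≤ K ^ 2 := fun j => by
      rw [Finset.sum_eq_single_of_mem j (Finset.mem_univ _) fun k _ hk => ho j k hk.symm]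
      refine (integral_mono (hint j j) (integrable_const (K ^ 2)) fun ω => ?_).trans (by simp)
      simpa [real_inner_self_eq_norm_sq] using pow_le_pow_left₀ (norm_nonneg _) (hb j ω) 2
    simp_rw [h1]
    rw [integral_const_mul, integral_finsetSum _ fun j _ => integrable_finsetSum _ fun k _ => hint j k]
    simp_rw [integral_finsetSum _ fun k _ => hint _ k]
    calc (1 / (m : ℝ)) ^ 2 * ∑ j, ∑ k, ∫ ω, ⟪ζ j ω, ζ k ω⟫ ∂P
        ≤ (1 / (m : ℝ)) ^ 2 * ∑ _j : Fin m, K ^ 2 := by gcongr with j; exact h2 j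
      _ = K ^ 2 / m := by
          obtain rfl | hm := eq_or_ne m 0
          · simp
          · simp; field_simp
  -- Nonnegative variance gives `(E‖·‖)² ≤ E‖·‖²`, which passes from the second moment to the first.
  have hvar := variance_nonneg (fun ω => ‖(1 / (m : ℝ)) • ∑ j, ζ j ω‖) P
  rw [variance_eq_sub hLp] at hvar
  refine le_of_sq_le_sq ?_ (by positivity)
  rw [div_pow, Real.sq_sqrt (Nat.cast_nonneg _)]
  simp only [Pi.pow_apply] at hvar
  linarith

/-! ### Dyadic nets and chaining -/

/-- In a finite-dimensional space, every ball can be covered by balls of half its radius whose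
centers are a scaled copy of one finite set. -/
theorem exists_finset_covering_half (E : Type*) [NormedAddCommGroup E] [NormedSpace ℝ E]
    [FiniteDimensional ℝ E] :
    ∃ T : Finset E, ∀ x r, 0 < r → ∀ y : E, ‖y - x‖ ≤ r → ∃ t ∈ T,
      ‖y - (x + r • t)‖ ≤ r / 2 := by
  have := FiniteDimensional.proper_real E
  obtain ⟨T, hfin, hT⟩ := Metric.totallyBounded_iff.1
    (isCompact_closedBall (0 : E) 1).totallyBounded (1 / 2) (by norm_num)
  refine ⟨hfin.toFinset, fun x r hr y hy => ?_⟩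
  have hmem : r⁻¹ • (y - x) ∈ Metric.closedBall (0 : E) 1 := by
    rw [mem_closedBall_zero_iff, norm_smul, Real.norm_of_nonneg (by positivity),
      inv_mul_le_iff₀ hr]
    linarith
  obtain ⟨t, ht, hyt⟩ := Set.mem_iUnion₂.1 (hT hmem)
  refine ⟨t, hfin.mem_toFinset.2 ht, ?_⟩
  rw [Metric.mem_ball, dist_eq_norm] at hyt
  have : y - (x + r • t) = r • (r⁻¹ • (y - x) - t) := by
    rw [smul_sub, smul_inv_smul₀ hr.ne', sub_sub]
  rw [this, norm_smul, Real.norm_of_nonneg hr.le]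
  nlinarith

/-- Compact subsets of finite-dimensional spaces have dyadic nets of at most exponential size. -/
theorem exists_dyadic_nets {E : Type*} [NormedAddCommGroup E] [NormedSpace ℝ E]
    [FiniteDimensional ℝ E] {𝒟 : Set E} (h𝒟 : IsCompact 𝒟) {θ₀ : E} (hθ₀ : θ₀ ∈ 𝒟) :
    ∃ (N : ℕ) (r : ℝ) (A : ℕ → Finset E), 1 ≤ N ∧ 0 < r ∧ A 0 = {θ₀} ∧ ∀ k,
      (∀ a ∈ A k, a ∈ 𝒟) ∧ (A k).card ≤ N ^ k ∧ ∀ θ ∈ 𝒟, ∃ a ∈ A k, ‖θ - a‖ ≤ r / 2 ^ k := by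
  classical
  obtain ⟨T, hT⟩ := exists_finset_covering_half E
  obtain ⟨s, hs, hs𝒟⟩ := h𝒟.isBounded.subset_closedBall_lt 0 θ₀
  have cover : ∀ k : ℕ, ∃ A : Finset E, A.card ≤ (T.card + 1) ^ k ∧
      ∀ θ ∈ 𝒟, ∃ a ∈ A, ‖θ - a‖ ≤ s / 2 ^ k := by
    intro k
    induction k with
    | zero =>
      refine ⟨{θ₀}, by simp, fun θ hθ => ⟨θ₀, by simp, ?_⟩⟩
      simpa [dist_eq_norm] using hs𝒟 hθ
    | succ k ih =>
      obtain ⟨A, hA, hcov⟩ := ih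
      refine ⟨(A ×ˢ T).image fun p => p.1 + (s / 2 ^ k) • p.2, ?_, fun θ hθ => ?_⟩
      · refine Finset.card_image_le.trans ?_
        rw [Finset.card_product, pow_succ]
        exact Nat.mul_le_mul hA (Nat.le_succ _)
      · obtain ⟨a, ha, hθa⟩ := hcov θ hθ
        obtain ⟨t, ht, hθt⟩ := hT a (s / 2 ^ k) (by positivity) θ hθa
        refine ⟨_, Finset.mem_image_of_mem _ (Finset.mk_mem_product ha ht), hθt.trans_eq ?_⟩
        rw [pow_succ, div_div]
  -- The centres found so far may lie outside `𝒟`, where the process is not controlled. Replacing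
  -- each by a point of `𝒟` in its ball doubles the radius; centres whose ball misses `𝒟` are sent
  -- to `θ₀`.
  have net : ∀ k : ℕ, ∃ A : Finset E, (∀ a ∈ A, a ∈ 𝒟) ∧ A.card ≤ (T.card + 1) ^ k ∧
      ∀ θ ∈ 𝒟, ∃ a ∈ A, ‖θ - a‖ ≤ 2 * s / 2 ^ k := by
    intro k
    obtain ⟨A, hA, hcov⟩ := cover k
    have choice : ∀ a : E, ∃ b ∈ 𝒟, (∃ θ ∈ 𝒟, ‖θ - a‖ ≤ s / 2 ^ k) → ‖b - a‖ ≤ s / 2 ^ k := by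
      intro a
      by_cases h : ∃ θ ∈ 𝒟, ‖θ - a‖ ≤ s / 2 ^ k
      · obtain ⟨b, hb, hba⟩ := h
        exact ⟨b, hb, fun _ => hba⟩
      · exact ⟨θ₀, hθ₀, fun h' => absurd h' h⟩
    choose g hg𝒟 hg using choice
    refine ⟨A.image g, ?_, Finset.card_image_le.trans hA, fun θ hθ => ?_⟩
    · intro a ha
      obtain ⟨b, -, rfl⟩ := Finset.mem_image.1 ha
      exact hg𝒟 b
    · obtain ⟨a, ha, hθa⟩ := hcov θ hθ
      refine ⟨g a, Finset.mem_image_of_mem g ha, ?_⟩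
      have h1 := norm_sub_le_norm_sub_add_norm_sub θ a (g a)
      have h2 := hg a ⟨θ, hθ, hθa⟩
      rw [norm_sub_rev] at h2
      rw [mul_div_assoc]
      linarith
  choose A hA using net
  refine ⟨T.card + 1, 2 * s, fun k => if k = 0 then {θ₀} else A k, by omega, by positivity,
    by simp, fun k => ?_⟩
  by_cases hk : k = 0
  · subst hk
    refine ⟨by simpa using hθ₀, by simp, fun θ hθ => ⟨θ₀, by simp, ?_⟩⟩
    have := hs𝒟 hθ
    rw [mem_closedBall_iff_norm] at this
    simp only [pow_zero, div_one]
    linarith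
  · simpa [hk] using hA k

/-- A maximal inequality: finitely many sub-Gaussian variables have a common integrable bound. -/
theorem exists_integrable_bound_of_hasSubgaussianMGF {Ω ι : Type*} [MeasurableSpace Ω]
    {P : Measure Ω} [IsProbabilityMeasure P] {X : ι → Ω → ℝ} {v : ι → ℝ≥0} (I : Finset ι)
    {b M : ℝ} (hb : 0 < b) (hM : 0 < M) (hcard : (I.card : ℝ) ≤ M)
    (hv : ∀ i ∈ I, (v i : ℝ) ≤ b ^ 2) (hX : ∀ i ∈ I, HasSubgaussianMGF (X i) (v i) P) :
    ∃ Q : Ω → ℝ, Integrable Q P ∧ (∀ i ∈ I, ∀ ω, |X i ω| ≤ Q ω) ∧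
      ∫ ω, Q ω ∂P ≤ b * (Real.log M + 4) := by
  -- At `t = ±1/b` the moment generating function is at most `exp (1/2) ≤ 2`.
  have hexp : ∀ i ∈ I, ∀ t : ℝ, t ^ 2 = b⁻¹ ^ 2 → ∫ ω, Real.exp (t * X i ω) ∂P ≤ 2 := by
    intro i hi t ht
    refine ((hX i hi).mgf_le t).trans ?_
    have h1 : (v i : ℝ) * t ^ 2 / 2 ≤ 1 / 2 := by
      rw [ht, inv_pow, ← div_eq_mul_inv]
      have := div_le_one_of_le₀ (hv i hi) (by positivity)
      linarith
    refine (Real.exp_le_exp.2 h1).trans ?_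
    have h2 := Real.exp_one_lt_d9
    have h3 : Real.exp (1 / 2) ^ 2 = Real.exp 1 := by rw [← Real.exp_nat_mul]; norm_num
    nlinarith [Real.exp_pos (1 / 2)]
  let e : ι → Ω → ℝ := fun i ω => Real.exp (b⁻¹ * X i ω) + Real.exp (-b⁻¹ * X i ω)
  have he : ∀ i ∈ I, Integrable (e i) P := fun i hi =>
    ((hX i hi).integrable_exp_mul _).add ((hX i hi).integrable_exp_mul _)
  have hee : ∀ i ∈ I, ∫ ω, e i ω ∂P ≤ 4 := fun i hi => by
    rw [integral_add ((hX i hi).integrable_exp_mul _) ((hX i hi).integrable_exp_mul _)]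
    linarith [hexp i hi b⁻¹ rfl, hexp i hi (-b⁻¹) (neg_sq _)]
  -- From `x + 1 ≤ exp x` at `x = |X|/b - log M` follows `|X|/b ≤ log M + M⁻¹ exp (|X|/b)`. Summing
  -- the exponentials over `I` makes the bound common to all `i`; the mean of that sum is at most `4
  -- M`.
  refine ⟨fun ω => b * (Real.log M + M⁻¹ * ∑ i ∈ I, e i ω), ?_, fun i hi ω => ?_, ?_⟩
  · exact ((integrable_const _).add ((integrable_finsetSum _ he).const_mul _)).const_mul _
  · have h1 : Real.exp (b⁻¹ * |X i ω|) ≤ e i ω := by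
      have p1 := Real.exp_pos (b⁻¹ * X i ω)
      have p2 := Real.exp_pos (-b⁻¹ * X i ω)
      rcases abs_cases (X i ω) with ⟨h, -⟩ | ⟨h, -⟩ <;> rw [h]
      · simp only [e]; linarith
      · rw [mul_neg, ← neg_mul]; simp only [e]; linarith
    have h2 : e i ω ≤ ∑ i ∈ I, e i ω :=
      Finset.single_le_sum (f := fun i => e i ω) (fun i _ => by positivity) hi
    have h3 := Real.add_one_le_exp (b⁻¹ * |X i ω| - Real.log M)
    rw [Real.exp_sub, Real.exp_log hM, div_eq_inv_mul] at h3
    have h4 := mul_le_mul_of_nonneg_left (h1.trans h2) (inv_nonneg.2 hM.le)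
    have h5 : b⁻¹ * |X i ω| ≤ Real.log M + M⁻¹ * ∑ i ∈ I, e i ω := by linarith
    rwa [inv_mul_le_iff₀ hb] at h5
  · rw [integral_const_mul, integral_add (integrable_const _)
      ((integrable_finsetSum _ he).const_mul _), integral_const_mul, integral_finsetSum _ he]
    have h1 : ∑ i ∈ I, ∫ ω, e i ω ∂P ≤ M * 4 := by
      refine (Finset.sum_le_card_nsmul _ _ 4 hee).trans ?_
      rw [nsmul_eq_mul]
      gcongr
    have h2 := mul_le_mul_of_nonneg_left h1 (inv_nonneg.2 hM.le)
    rw [inv_mul_cancel_left₀ hM.ne'] at h2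
    refine mul_le_mul_of_nonneg_left ?_ hb.le
    simpa using h2

/-- Chaining: a process with sub-Gaussian increments and Lipschitz paths that is indexed by a
compact subset of a finite-dimensional space has oscillation of the order of its sub-Gaussian
constant. -/
theorem exists_chaining_bound {E : Type*} [NormedAddCommGroup E] [NormedSpace ℝ E]
    [FiniteDimensional ℝ E] {𝒟 : Set E} (h𝒟 : IsCompact 𝒟) {θ₀ : E} (hθ₀ : θ₀ ∈ 𝒟) :
    ∃ c : ℝ, 0 < c ∧ ∀ {Ω : Type*} [MeasurableSpace Ω] (P : Measure Ω) [IsProbabilityMeasure P]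
      (Z : E → Ω → ℝ) (σ : ℝ≥0) (Λ : ℝ), 0 < σ → 0 ≤ Λ →
      (∀ a ∈ 𝒟, ∀ b ∈ 𝒟,
        HasSubgaussianMGF (fun ω => Z a ω - Z b ω) ((σ * ‖a - b‖₊) ^ 2) P) →
      (∀ a ∈ 𝒟, ∀ b ∈ 𝒟, ∀ ω, |Z a ω - Z b ω| ≤ Λ * ‖a - b‖) →
      ∃ G : Ω → ℝ, Integrable G P ∧ (∀ θ ∈ 𝒟, ∀ ω, |Z θ ω - Z θ₀ ω| ≤ G ω) ∧
        ∫ ω, G ω ∂P ≤ c * σ := by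
  obtain ⟨N, r, A, hN, hr, hA₀, hA⟩ := exists_dyadic_nets h𝒟 hθ₀
  have hlogN : 0 ≤ Real.log N := Real.log_natCast_nonneg N
  -- The factor `4` bounds `∑ (k + 1) / 2 ^ k`; the `1` pays for the Lipschitz remainder at the last
  -- level.
  refine ⟨2 * r * (2 * Real.log N + 4) * 4 + 1, by positivity, ?_⟩
  intro Ω _ P _ Z σ Λ hσ hΛ hsub hlip
  have hσ' : (0 : ℝ) < σ := hσ
  have hN' : (0 : ℝ) < N := by exact_mod_cast hN
  -- Level `k` has at most `N ^ (2k + 1)` links, each sub-Gaussian at scale `σ * 2r / 2 ^ k`. The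
  -- logarithm of their number is linear in `k`, so the costs are summable.
  have level : ∀ k : ℕ, ∃ Q : Ω → ℝ, Integrable Q P ∧
      (∀ a ∈ A k, ∀ b ∈ A (k + 1), ‖a - b‖ ≤ 2 * r / 2 ^ k → ∀ ω, |Z b ω - Z a ω| ≤ Q ω) ∧
      ∫ ω, Q ω ∂P ≤ 2 * r * (2 * Real.log N + 4) * σ * ((k + 1) / 2 ^ k) := by
    intro k
    classical
    have hcard : ((((A k ×ˢ A (k + 1)).filter fun p => ‖p.1 - p.2‖ ≤ 2 * r / 2 ^ k).card : ℕ) : ℝ)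
        ≤ (N : ℝ) ^ (2 * k + 1) := by
      have h1 : (A k ×ˢ A (k + 1)).card ≤ N ^ (2 * k + 1) := by
        rw [Finset.card_product, show 2 * k + 1 = k + (k + 1) by ring, pow_add]
        exact Nat.mul_le_mul (hA k).2.1 (hA (k + 1)).2.1
      exact_mod_cast (Finset.card_filter_le _ _).trans h1
    obtain ⟨Q, hQ, hQb, hQi⟩ := exists_integrable_bound_of_hasSubgaussianMGF (P := P)
      (X := fun (p : E × E) ω => Z p.2 ω - Z p.1 ω) (v := fun p => (σ * ‖p.2 - p.1‖₊) ^ 2)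
      ((A k ×ˢ A (k + 1)).filter fun p => ‖p.1 - p.2‖ ≤ 2 * r / 2 ^ k)
      (b := σ * (2 * r / 2 ^ k)) (by positivity) (by positivity) hcard
      (fun p hp => by
        have := (Finset.mem_filter.1 hp).2
        rw [norm_sub_rev] at this
        push_cast
        gcongr)
      (fun p hp => by
        have := Finset.mem_product.1 (Finset.mem_filter.1 hp).1
        exact hsub _ ((hA _).1 _ this.2) _ ((hA _).1 _ this.1))
    refine ⟨Q, hQ, fun a ha b hb hab ω => hQb (a, b) (by simp [ha, hb, hab]) ω, hQi.trans ?_⟩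
    rw [Real.log_pow]
    push_cast
    have h1 : (2 * (k : ℝ) + 1) * Real.log N + 4 ≤ (2 * Real.log N + 4) * (k + 1) := by
      nlinarith [(Nat.cast_nonneg k : (0 : ℝ) ≤ k)]
    calc σ * (2 * r / 2 ^ k) * ((2 * (k : ℝ) + 1) * Real.log N + 4)
        ≤ σ * (2 * r / 2 ^ k) * ((2 * Real.log N + 4) * (k + 1)) := by gcongr
      _ = _ := by ring
  choose Q hQ hQb hQi using level
  -- The chain stops at a finite level `K`, where Lipschitz paths leave an error of at most `σ`.
  -- Only `K` depends on `Λ`, not the constant.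
  obtain ⟨K, hK⟩ := exists_nat_gt (Λ * r / σ)
  have hK' : Λ * (r / 2 ^ K) ≤ σ := by
    have h1 : (K : ℝ) ≤ 2 ^ K := by exact_mod_cast Nat.lt_two_pow_self.le
    rw [← mul_div_assoc, div_le_iff₀ (by positivity), ← div_le_iff₀' hσ']
    linarith
  refine ⟨fun ω => ∑ k ∈ Finset.range K, Q k ω + σ,
    (integrable_finsetSum _ fun k _ => hQ k).add (integrable_const _), fun θ hθ ω => ?_, ?_⟩
  · choose a ha hθa using fun k => (hA k).2.2 θ hθ
    have tele : ∀ n, |Z (a n) ω - Z θ₀ ω| ≤ ∑ k ∈ Finset.range n, Q k ω := by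
      intro n
      induction n with
      | zero =>
        have := ha 0
        rw [hA₀, Finset.mem_singleton] at this
        simp [this]
      | succ n ih =>
        rw [Finset.sum_range_succ]
        have hdist : ‖a n - a (n + 1)‖ ≤ 2 * r / 2 ^ n := by
          have h1 := norm_sub_le_norm_sub_add_norm_sub (a n) θ (a (n + 1))
          have h2 := hθa n
          have h3 := hθa (n + 1)
          have h4 : r / 2 ^ (n + 1) ≤ r / 2 ^ n := by
            gcongr
            · norm_num
            · omega
          rw [norm_sub_rev] at h2
          rw [mul_div_assoc]
          linarith
        have h5 := hQb n _ (ha n) _ (ha (n + 1)) hdist ω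
        have h6 := abs_sub_le (Z (a (n + 1)) ω) (Z (a n) ω) (Z θ₀ ω)
        linarith
    have h1 := hlip θ hθ (a K) ((hA K).1 _ (ha K)) ω
    have h2 := mul_le_mul_of_nonneg_left (hθa K) hΛ
    have h3 := abs_sub_le (Z θ ω) (Z (a K) ω) (Z θ₀ ω)
    have h4 := tele K
    dsimp only
    linarith
  · rw [integral_add (integrable_finsetSum _ fun k _ => hQ k) (integrable_const _),
      integral_finsetSum _ fun k _ => hQ k]
    have hsum : ∀ n : ℕ, ∑ k ∈ Finset.range n, ((k : ℝ) + 1) / 2 ^ k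
        = 4 - 2 * (n + 2) / 2 ^ n := by
      intro n
      induction n with
      | zero => norm_num
      | succ n ih => rw [Finset.sum_range_succ, ih]; push_cast; field_simp; ring
    have h1 : ∑ k ∈ Finset.range K, ((k : ℝ) + 1) / 2 ^ k ≤ 4 := by
      rw [hsum]
      have : (0 : ℝ) ≤ 2 * (K + 2) / 2 ^ K := by positivity
      linarith
    have h2 : ∑ k ∈ Finset.range K, ∫ ω, Q k ω ∂P
        ≤ 2 * r * (2 * Real.log N + 4) * σ * 4 := by
      refine (Finset.sum_le_sum fun k _ => hQi k).trans ?_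
      rw [← Finset.mul_sum]
      gcongr
    simp only [integral_const, probReal_univ, one_smul]
    linarith

/-! ### Uniform law of large numbers -/

/-- Centered empirical means of a bounded function are sub-Gaussian. -/
theorem hasSubgaussianMGF_empirical_mean {X : Type*} [MeasurableSpace X] {Q : Measure X}
    [IsProbabilityMeasure Q] {h : X → ℝ} (hm : Measurable h) {K : ℝ≥0}
    (hb : ∀ x, |h x| ≤ K) {n : ℕ} (hn : 1 ≤ n) :
    HasSubgaussianMGF (fun S : Fin n → X => 1 / (n : ℝ) * ∑ i, h (S i) - ∫ x, h x ∂Q)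
      (((NNReal.sqrt n)⁻¹ * K) ^ 2) (Measure.pi fun _ => Q) := by
  have h1 := hasSubgaussianMGF_of_mem_Icc (μ := Q) hm.aemeasurable
    (ae_of_all _ fun x => abs_le.1 (hb x))
  -- Hoeffding's lemma on `[-K, K]`: half the length of the interval is `K`.
  rw [show (‖(K : ℝ) - -K‖₊ / 2) ^ 2 = K ^ 2 from NNReal.eq (by simp [← two_mul])] at h1
  have h2 : ∀ i : Fin n, HasSubgaussianMGF (fun S : Fin n → X => h (S i) - ∫ x, h x ∂Q)
      (K ^ 2) (Measure.pi fun _ => Q) := fun i => by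
    refine HasSubgaussianMGF.of_map (Y := fun S : Fin n → X => S i)
      (X := fun x => h x - ∫ x, h x ∂Q) (measurable_pi_apply i).aemeasurable ?_
    rwa [(measurePreserving_eval (fun _ : Fin n => Q) i).map_eq]
  have hind : iIndepFun (fun (i : Fin n) (S : Fin n → X) => h (S i) - ∫ x, h x ∂Q)
      (Measure.pi fun _ => Q) :=
    iIndepFun_pi (X := fun _ x => h x - ∫ x, h x ∂Q) fun i => (hm.sub_const _).aemeasurable
  have h3 := (HasSubgaussianMGF.sum_of_iIndepFun hind (s := Finset.univ)
    fun i _ => h2 i).const_mul (1 / (n : ℝ))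
  have hn' : (n : ℝ) ≠ 0 := by positivity
  convert h3 using 1
  · ext S
    rw [Finset.sum_sub_distrib]
    simp
    field_simp
  · refine NNReal.eq ?_
    change _ = (1 / (n : ℝ)) ^ 2 * ((∑ _i : Fin n, K ^ 2 : ℝ≥0) : ℝ)
    rw [mul_pow, inv_pow, NNReal.sq_sqrt]
    simp
    field_simp

/-- Uniform law of large numbers at the parametric rate for the increments of a bounded class of
functions that is Lipschitz in a compact finite-dimensional parameter. -/
theorem exists_empirical_process_bound {E : Type*} [NormedAddCommGroup E] [NormedSpace ℝ E]
    [FiniteDimensional ℝ E] {𝒟 : Set E} (h𝒟 : IsCompact 𝒟) {θ₀ : E} (hθ₀ : θ₀ ∈ 𝒟)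
    {X : Type*} [MeasurableSpace X] (Q : Measure X) [IsProbabilityMeasure Q] {g : X → E → ℝ}
    (hm : ∀ θ ∈ 𝒟, Measurable fun x => g x θ) (hi : ∀ θ ∈ 𝒟, Integrable (fun x => g x θ) Q)
    {L : ℝ} (hL : ∀ a ∈ 𝒟, ∀ b ∈ 𝒟, ∀ x, |g x a - g x b| ≤ L * ‖a - b‖) :
    ∃ c : ℝ, 0 < c ∧ ∀ n : ℕ, 1 ≤ n → ∃ G : (Fin n → X) → ℝ,
      Integrable G (Measure.pi fun _ => Q) ∧
      (∀ θ ∈ 𝒟, ∀ S, |(1 / (n : ℝ) * ∑ i, g (S i) θ - ∫ x, g x θ ∂Q)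
          - (1 / (n : ℝ) * ∑ i, g (S i) θ₀ - ∫ x, g x θ₀ ∂Q)| ≤ G S) ∧
      ∫ S, G S ∂(Measure.pi fun _ => Q) ≤ c / √n := by
  obtain ⟨c, hc, chain⟩ := exists_chaining_bound h𝒟 hθ₀
  -- Chaining needs a positive scale, so `L` is enlarged to a positive constant.
  obtain ⟨L, hL0, hL⟩ : ∃ L : ℝ≥0, 0 < L ∧
      ∀ a ∈ 𝒟, ∀ b ∈ 𝒟, ∀ x, |g x a - g x b| ≤ L * ‖a - b‖ :=
    ⟨L.toNNReal + 1, by positivity, fun a ha b hb x => (hL a ha b hb x).trans (by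
      push_cast
      gcongr
      linarith [Real.le_coe_toNNReal L])⟩
  refine ⟨c * L, by positivity, fun n hn => ?_⟩
  have hn' : (n : ℝ) ≠ 0 := by positivity
  have hn'' : (0 : ℝ≥0) < n := by exact_mod_cast hn
  -- Increments of the process are again centred empirical means, of functions bounded by `L * ‖a -
  -- b‖`.
  have hdiff : ∀ a ∈ 𝒟, ∀ b ∈ 𝒟, ∀ S : Fin n → X,
      (1 / (n : ℝ) * ∑ i, g (S i) a - ∫ x, g x a ∂Q)
        - (1 / (n : ℝ) * ∑ i, g (S i) b - ∫ x, g x b ∂Q)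
      = 1 / (n : ℝ) * ∑ i, (g (S i) a - g (S i) b) - ∫ x, (g x a - g x b) ∂Q := by
    intro a ha b hb S
    rw [Finset.sum_sub_distrib, integral_sub (hi a ha) (hi b hb)]
    ring
  obtain ⟨G, hG, hGb, hGi⟩ := chain (Measure.pi fun _ : Fin n => Q)
    (fun θ S => 1 / (n : ℝ) * ∑ i, g (S i) θ - ∫ x, g x θ ∂Q) ((NNReal.sqrt n)⁻¹ * L) (2 * L)
    (by have := NNReal.sqrt_pos.2 hn''; positivity) (by positivity)
    (fun a ha b hb => by
      simp_rw [hdiff a ha b hb]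
      rw [mul_assoc]
      exact hasSubgaussianMGF_empirical_mean ((hm a ha).sub (hm b hb))
        (by simpa using hL a ha b hb) hn)
    (fun a ha b hb S => by
      rw [hdiff a ha b hb]
      have h1 : |1 / (n : ℝ) * ∑ i, (g (S i) a - g (S i) b)| ≤ L * ‖a - b‖ := by
        rw [abs_mul, abs_of_nonneg (by positivity), one_div, inv_mul_le_iff₀ (by positivity)]
        refine (Finset.abs_sum_le_sum_abs _ _).trans
          ((Finset.sum_le_card_nsmul _ _ _ fun i _ => hL a ha b hb (S i)).trans_eq ?_)
        simp
      have h2 : |∫ x, (g x a - g x b) ∂Q| ≤ L * ‖a - b‖ := by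
        refine (norm_integral_le_of_norm_le_const (μ := Q)
          (f := fun x => g x a - g x b) (C := L * ‖a - b‖)
          (ae_of_all _ fun x => hL a ha b hb x)).trans_eq ?_
        simp
      have := abs_sub (1 / (n : ℝ) * ∑ i, (g (S i) a - g (S i) b)) (∫ x, (g x a - g x b) ∂Q)
      linarith)
  refine ⟨G, hG, hGb, hGi.trans_eq ?_⟩
  push_cast
  field_simp

/-! ### Markov's inequality and averages of Hilbert-space-valued data -/

/-- Bounds in expectation and with high probability for a possibly non-measurable function that is
dominated by an integrable one. -/
theorem lintegral_le_and_measure_le_of_ae_le {Ω : Type*} [MeasurableSpace Ω] {P : Measure Ω}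
    {e G : Ω → ℝ} (hG : Integrable G P) (hG0 : ∀ ω, 0 ≤ G ω) (he : ∀ᵐ ω ∂P, e ω ≤ G ω)
    {a : ℝ} (ha : 0 < a) (hint : ∫ ω, G ω ∂P ≤ a) :
    (∀ δ ∈ Set.Ioo (0 : ℝ) 1, P {ω | ¬ e ω ≤ a / δ} ≤ ENNReal.ofReal δ) ∧
      ∫⁻ ω, ENNReal.ofReal (e ω) ∂P ≤ ENNReal.ofReal a := by
  have hlint : ∫⁻ ω, ENNReal.ofReal (G ω) ∂P ≤ ENNReal.ofReal a := by
    rw [← ofReal_integral_eq_lintegral_ofReal hG (ae_of_all _ hG0)]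
    exact ENNReal.ofReal_le_ofReal hint
  refine ⟨fun δ hδ => ?_, (lintegral_mono_ae ?_).trans hlint⟩
  · have h1 : P {ω | ¬ e ω ≤ a / δ}
        ≤ P {ω | ENNReal.ofReal (a / δ) ≤ ENNReal.ofReal (G ω)} := by
      refine measure_mono_ae ?_
      filter_upwards [he] with ω hω h
      exact ENNReal.ofReal_le_ofReal ((not_le.1 h).le.trans hω)
    have hpos : 0 < a / δ := div_pos ha hδ.1
    have h2 := (mul_meas_ge_le_lintegral₀ hG.aemeasurable.ennreal_ofReal
      (ENNReal.ofReal (a / δ))).trans hlint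
    rw [mul_comm, ← ENNReal.le_div_iff_mul_le (Or.inl (by simpa using hpos)) (Or.inl (by simp)),
      ← ENNReal.ofReal_div_of_pos hpos, div_div_cancel₀ ha.ne'] at h2
    exact h1.trans h2
  · filter_upwards [he] with ω hω using ENNReal.ofReal_le_ofReal hω

/-- The mean of i.i.d. centered random vectors that are bounded by `K` has expected norm at most
`K / √m`. -/
theorem integral_norm_mean_iid_le {Z F : Type*} [MeasurableSpace Z] [NormedAddCommGroup F]
    [InnerProductSpace ℝ F] [CompleteSpace F] {ν : Measure Z} [IsProbabilityMeasure ν] {m n : ℕ}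
    (h : m ≤ n) {η : Z → F} (hη : StronglyMeasurable η) {K : ℝ} (hb : ∀ z, ‖η z‖ ≤ K)
    (h0 : ∫ z, η z ∂ν = 0) :
    Integrable (fun S => ‖(1 / (m : ℝ)) • ∑ j, η (firstPart h S j)‖)
        (Measure.pi fun _ : Fin n => ν) ∧
      ∫ S, ‖(1 / (m : ℝ)) • ∑ j, η (firstPart h S j)‖ ∂(Measure.pi fun _ : Fin n => ν)
        ≤ K / √m := by
  obtain ⟨z₀⟩ : Nonempty Z := nonempty_of_isProbabilityMeasure ν
  have hK : 0 ≤ K := (norm_nonneg _).trans (hb z₀)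
  have hm : ∀ j, StronglyMeasurable fun S : Fin n → Z => η (firstPart h S j) := fun j =>
    hη.comp_measurable (measurable_pi_apply _)
  refine integral_norm_mean_le_of_orthogonal hK hm (fun j S => hb _) fun j k hjk => ?_
  refine integral_pi_eq_zero_of_integral_update_eq_zero (Fin.castLE h j) ?_ fun S => ?_
  · exact Integrable.of_bound ((hm j).inner (hm k)).aestronglyMeasurable (K * K)
      (ae_of_all _ fun S => (norm_inner_le_norm _ _).trans
        (mul_le_mul (hb _) (hb _) (norm_nonneg _) hK))
  · have hne : Fin.castLE h k ≠ Fin.castLE h j := fun e => hjk (Fin.castLE_injective h e).symm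
    simp only [firstPart, Function.update_self, Function.update_of_ne hne]
    refine (integral_congr_ae (ae_of_all _ fun z => real_inner_comm _ _)).trans ?_
    rw [integral_inner (Integrable.of_bound hη.aestronglyMeasurable K (ae_of_all _ hb)), h0,
      inner_zero_right]

/-- Noise vectors that are centered given the covariates, averaged with bounded weights that only
depend on the covariates and on independent data, have expected norm of order `m ^ (-1 / 2)`. -/
theorem integral_norm_weighted_noise_le {X Y T F : Type*} [MeasurableSpace X] [MeasurableSpace Y]
    [MeasurableSpace T] [NormedAddCommGroup F] [InnerProductSpace ℝ F] [CompleteSpace F]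
    {P : Measure X} [IsProbabilityMeasure P] {κ : Kernel X Y} [IsMarkovKernel κ]
    {τ : Measure T} [IsProbabilityMeasure τ] {m n : ℕ} (h : m ≤ n)
    {w : (Fin m → X) → T → Fin m → ℝ}
    (hw : Measurable fun p : (Fin m → X) × T => w p.1 p.2) {B : ℝ} (hB : 0 ≤ B)
    (hwB : ∀ x t j, w x t j ∈ Set.Icc 0 B) {ξ : X × Y → F} (hξ : StronglyMeasurable ξ) {K : ℝ}
    (hK : 0 ≤ K) (hb : ∀ z, ‖ξ z‖ ≤ K) (h0 : ∀ x, ∫ y, ξ (x, y) ∂(κ x) = 0) :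
    Integrable (fun S : (Fin n → X × Y) × T =>
        ‖(1 / (m : ℝ)) • ∑ j, w (fun i => (firstPart h S.1 i).1) S.2 j • ξ (firstPart h S.1 j)‖)
        ((Measure.pi fun _ : Fin n => P ⊗ₘ κ).prod τ) ∧
      ∫ S, ‖(1 / (m : ℝ)) • ∑ j, w (fun i => (firstPart h S.1 i).1) S.2 j • ξ (firstPart h S.1 j)‖
        ∂((Measure.pi fun _ : Fin n => P ⊗ₘ κ).prod τ) ≤ B * K / √m := by
  have hcov : Measurable fun S : (Fin n → X × Y) × T =>
      ((fun i => (firstPart h S.1 i).1, S.2) : (Fin m → X) × T) := by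
    unfold firstPart
    fun_prop
  have hwm : ∀ j, Measurable fun S : (Fin n → X × Y) × T =>
      w (fun i => (firstPart h S.1 i).1) S.2 j := fun j =>
    (measurable_pi_apply j).comp (hw.comp hcov)
  have hm : ∀ j, StronglyMeasurable fun S : (Fin n → X × Y) × T =>
      w (fun i => (firstPart h S.1 i).1) S.2 j • ξ (firstPart h S.1 j) := fun j =>
    (hwm j).stronglyMeasurable.smul
      (hξ.comp_measurable ((measurable_pi_apply _).comp measurable_fst))
  have hbd : ∀ j (S : (Fin n → X × Y) × T),
      ‖w (fun i => (firstPart h S.1 i).1) S.2 j • ξ (firstPart h S.1 j)‖ ≤ B * K := by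
    intro j S
    rw [norm_smul, Real.norm_of_nonneg (hwB _ _ _).1]
    exact mul_le_mul (hwB _ _ _).2 (hb _) (norm_nonneg _) hB
  refine integral_norm_mean_le_of_orthogonal (by positivity) hm hbd fun j k hjk => ?_
  have hbd2 : ∀ S : (Fin n → X × Y) × T,
      ‖⟪w (fun i => (firstPart h S.1 i).1) S.2 j • ξ (firstPart h S.1 j),
        w (fun i => (firstPart h S.1 i).1) S.2 k • ξ (firstPart h S.1 k)⟫‖
        ≤ B * K * (B * K) := fun S =>
    (norm_inner_le_norm _ _).trans
      (mul_le_mul (hbd j S) (hbd k S) (norm_nonneg _) (by positivity))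
  refine integral_pi_prod_eq_zero_of_integral_update_eq_zero (Fin.castLE h j)
    (Integrable.of_bound ((hm j).inner (hm k)).aestronglyMeasurable _ (ae_of_all _ hbd2))
    fun S t => ?_
  have hupd : Measurable fun z : X × Y => (Function.update S (Fin.castLE h j) z, t) :=
    (measurable_update S).prodMk measurable_const
  rw [Measure.integral_compProd (Integrable.of_bound
    (((hm j).inner (hm k)).comp_measurable hupd).aestronglyMeasurable _
    (ae_of_all _ fun z => hbd2 _))]
  refine integral_eq_zero_of_ae (ae_of_all _ fun x => ?_)
  have hne : Fin.castLE h k ≠ Fin.castLE h j := fun e => hjk (Fin.castLE_injective h e).symm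
  -- Relabelling point `j` leaves every weight unchanged. Given `x`, both weights therefore come out
  -- of the integral over `y`, and the centred factor integrates to zero.
  have hx : ∀ y, (fun i => (firstPart h (Function.update S (Fin.castLE h j) (x, y)) i).1)
      = Function.update (fun i => (firstPart h S i).1) j x := by
    intro y
    ext i
    obtain rfl | hi := eq_or_ne i j
    · simp [firstPart]
    · have hi' : Fin.castLE h i ≠ Fin.castLE h j := fun e => hi (Fin.castLE_injective h e)
      simp [firstPart, hi, hi']
  simp only [hx]
  simp only [firstPart, Function.update_self, Function.update_of_ne hne, real_inner_smul_left,
    real_inner_smul_right, Pi.zero_apply]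
  simp_rw [real_inner_comm]
  rw [integral_const_mul, integral_const_mul, integral_inner, h0, inner_zero_right, mul_zero,
    mul_zero]
  exact Integrable.of_bound
    (hξ.comp_measurable measurable_prodMk_left).aestronglyMeasurable K (ae_of_all _ fun y => hb _)

/-! ### Bounded density and split size -/

/-- A bounded density has an everywhere bounded version. -/
theorem exists_bounded_density {X F : Type*} [MeasurableSpace X] [NormedAddCommGroup F]
    [NormedSpace ℝ F] {P Q : Measure X} [SigmaFinite P] [SigmaFinite Q] (h : Q ≪ P) {B : ℝ}
    (hB0 : 0 ≤ B) (hB : ∀ᵐ x ∂P, Q.rnDeriv P x ≤ ENNReal.ofReal B) (g : X → F) :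
    ∃ b : X → ℝ, Measurable b ∧ (∀ x, b x ∈ Set.Icc 0 B) ∧ ∫ x, b x • g x ∂P = ∫ x, g x ∂Q := by
  refine ⟨fun x => min (Q.rnDeriv P x).toReal B,
    (Measure.measurable_rnDeriv Q P).ennreal_toReal.min measurable_const,
    fun x => ⟨le_min ENNReal.toReal_nonneg hB0, min_le_right _ _⟩, ?_⟩
  rw [← integral_rnDeriv_smul h]
  refine integral_congr_ae ?_
  filter_upwards [hB] with x hx
  rw [min_eq_left (ENNReal.toReal_le_of_le_ofReal hB0 hx)]

/-- The split size is of the order of the sample size. -/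
theorem inv_sqrt_splitSize_le {ρ : ℝ} (hρ : 0 < ρ) {n : ℕ} (h : 1 ≤ splitSize ρ n) :
    1 / √(splitSize ρ n) ≤ √(2 / ρ) * (n : ℝ) ^ (-(1 / 2) : ℝ) := by
  -- With `m = splitSize ρ n ≥ 1`, this gives `ρ n < m + 1 ≤ 2 m`, hence the factor `2 / ρ`.
  have h1 : ρ * n < splitSize ρ n + 1 := Nat.lt_floor_add_one _
  have h2 : (1 : ℝ) ≤ splitSize ρ n := by exact_mod_cast h
  have hn : (0 : ℝ) < n := by
    obtain rfl | hn := Nat.eq_zero_or_pos n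
    · simp [splitSize] at h
    · exact_mod_cast hn
  rw [Real.rpow_neg hn.le, ← Real.sqrt_eq_rpow, ← Real.sqrt_inv, ← Real.sqrt_mul (by positivity),
    one_div, ← Real.sqrt_inv]
  refine Real.sqrt_le_sqrt ?_
  rw [← div_eq_mul_inv, div_div, inv_le_iff_one_le_mul₀ (by positivity), div_mul_eq_mul_div,
    le_div_iff₀ (by positivity)]
  linarith

/-! ### Deterministic bounds for the robust risk -/

/-- The deviation of the robust risk from the empirical risk of the conditional loss is controlled
by a weighted noise term and by the kernel mean matching residual. -/
theorem abs_robustRisk_sub_le {X Y E H F : Type*}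
    [NormedAddCommGroup H] [InnerProductSpace ℝ H] [NormedAddCommGroup F] [InnerProductSpace ℝ F]
    {m n : ℕ} {φ : X → H} {ξ : X × Y → F} {loss : X → Y → E → ℝ} {l lhat : X → E → ℝ}
    {f : X → ℝ} {θ : E} {u uhat : H} {Λ : F} {C : ℝ} (hu : ‖u‖ ≤ C) (huhat : ‖uhat‖ ≤ C)
    (hΛ : ‖Λ‖ ≤ C) (hξ : ∀ z, ⟪ξ z, Λ⟫ = loss z.1 z.2 θ - l z.1 θ)
    (hl : ∀ x, l x θ = ⟪φ x, u⟫ + f x) (hlhat : ∀ x, lhat x θ = ⟪φ x, uhat⟫ + f x)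
    (b : Fin m → ℝ) (z : Fin m → X × Y) (x' : Fin n → X) :
    |robustRisk loss lhat b z x' θ - 1 / (n : ℝ) * ∑ i, l (x' i) θ|
      ≤ C * ‖(1 / (m : ℝ)) • ∑ j, b j • ξ (z j)‖
        + 2 * C * ‖(1 / (m : ℝ)) • ∑ j, b j • φ (z j).1 - (1 / (n : ℝ)) • ∑ i, φ (x' i)‖ := by
  have key : robustRisk loss lhat b z x' θ - 1 / (n : ℝ) * ∑ i, l (x' i) θ
      = ⟪(1 / (m : ℝ)) • ∑ j, b j • ξ (z j), Λ⟫
        + ⟪(1 / (m : ℝ)) • ∑ j, b j • φ (z j).1 - (1 / (n : ℝ)) • ∑ i, φ (x' i), u - uhat⟫ := by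
    have h1 : ∀ x, ⟪φ x, u - uhat⟫ = l x θ - lhat x θ := fun x => by
      rw [inner_sub_right, hl, hlhat]; ring
    rw [inner_sub_left]
    simp only [real_inner_smul_left, sum_inner, hξ, h1, robustRisk]
    simp only [mul_sub, Finset.sum_sub_distrib]
    ring
  rw [key]
  refine (abs_add_le _ _).trans (add_le_add ?_ ?_)
  · refine (abs_real_inner_le_norm _ _).trans ?_
    rw [mul_comm]
    gcongr
  · refine (abs_real_inner_le_norm _ _).trans ?_
    rw [mul_comm]
    gcongr
    exact (norm_sub_le _ _).trans (by linarith)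

/-- Kernel mean matching weights have a residual at most that of any other admissible weights,
hence at most the sum of the two deviations from a common mean. -/
theorem IsKMMWeights.norm_residual_le {X H : Type*} [NormedAddCommGroup H]
    [InnerProductSpace ℝ H] [CompleteSpace H] [RKHS ℝ H X ℝ] {m n : ℕ} (hm : 1 ≤ m) (hn : 1 ≤ n)
    {B : ℝ} {x : Fin m → X} {x' : Fin n → X} {b : Fin m → ℝ} (h : IsKMMWeights H B x x' b)
    {β : X → ℝ} (hβ : ∀ x, β x ∈ Set.Icc 0 B) (μ : H) :
    ‖(1 / (m : ℝ)) • ∑ j, b j • featureMap H (x j) - (1 / (n : ℝ)) • ∑ i, featureMap H (x' i)‖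
      ≤ ‖(1 / (m : ℝ)) • ∑ j, (β (x j) • featureMap H (x j) - μ)‖
        + ‖(1 / (n : ℝ)) • ∑ i, (featureMap H (x' i) - μ)‖ := by
  have mean : ∀ {k : ℕ} (_ : 1 ≤ k) (v : Fin k → H),
      (1 / (k : ℝ)) • ∑ i, (v i - μ) = (1 / (k : ℝ)) • ∑ i, v i - μ := by
    intro k hk v
    have hk' : (k : ℝ) ≠ 0 := by positivity
    rw [Finset.sum_sub_distrib, smul_sub, Finset.sum_const, Finset.card_univ, Fintype.card_fin,
      ← Nat.cast_smul_eq_nsmul ℝ, smul_smul, one_div_mul_cancel hk', one_smul]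
  -- The weights `β (x j)` compete in the quadratic program.
  have h1 := le_of_sq_le_sq (h.2 (fun j => β (x j)) fun j => hβ _) (norm_nonneg _)
  refine h1.trans ?_
  rw [mean hm, mean hn, ← sub_sub_sub_cancel_right _ _ μ]
  exact norm_sub_le _ _

/-- The risk is the mean of the conditional loss. -/
theorem risk_eq_integral_condLoss {X Y E : Type*} [MeasurableSpace X] [MeasurableSpace Y]
    {P : Measure X} [SFinite P] {κ : Kernel X Y} [IsSFiniteKernel κ] {loss : X → Y → E → ℝ}
    {θ : E} (h : Integrable (fun z : X × Y => loss z.1 z.2 θ) (P ⊗ₘ κ)) :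
    risk P κ loss θ = ∫ x, condLoss κ loss x θ ∂P :=
  Measure.integral_compProd h

/-! ### Assembly of the rate -/

theorem theorem2
    -- covariates, and labels in `𝒴 ⊆ [0, 1]`
    {X : Type*} [TopologicalSpace X] [CompactSpace X] [MeasurableSpace X] [BorelSpace X]
    (𝒴 : Set ℝ) (h𝒴 : 𝒴 ⊆ Set.Icc 0 1)
    -- the RKHS with its bounded canonical feature map, and the bounded feature map `Υ`
    {H : Type*} [NormedAddCommGroup H] [InnerProductSpace ℝ H] [CompleteSpace H] [RKHS ℝ H X ℝ]
    {F : Type*} [NormedAddCommGroup F] [InnerProductSpace ℝ F] [CompleteSpace F]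
    (R : ℝ) (hΦ_meas : StronglyMeasurable (featureMap H : X → H))
    (hΦ : ∀ x : X, ‖featureMap H x‖ ≤ R)
    (Υ : X × 𝒴 → F) (hΥ_meas : StronglyMeasurable Υ) (hΥ : ∀ z, ‖Υ z‖ ≤ R)
    -- covariate shift: different marginals, one common conditional law of the label
    (Ptr Pte : Measure X) [IsProbabilityMeasure Ptr] [IsProbabilityMeasure Pte]
    (κ : Kernel X 𝒴) [IsMarkovKernel κ]
    -- the density of `Pte` with respect to `Ptr` exists and is bounded by `B`
    (B : ℝ) (h_ac : Pte ≪ Ptr) (hB : ∀ᵐ x ∂Ptr, Pte.rnDeriv Ptr x ≤ ENNReal.ofReal B)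
    -- the compact parameter set
    {E : Type*} [NormedAddCommGroup E] [NormedSpace ℝ E] [FiniteDimensional ℝ E]
    (𝒟 : Set E) (h𝒟 : IsCompact 𝒟)
    -- the losses `l'` and `l`: linear in the feature plus a common term `f`
    (loss : X → 𝒴 → E → ℝ) (f : X → E → ℝ) (C : ℝ)
    (h_loss : ∀ θ ∈ 𝒟, ∃ Λ : F, ‖Λ‖ ≤ C ∧ ∀ x y, loss x y θ = ⟪Υ (x, y), Λ⟫ + f x θ)
    (h_cond : ∀ θ ∈ 𝒟, ∃ u : H, ‖u‖ ≤ C ∧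
      ∀ x, condLoss κ loss x θ = ⟪featureMap H x, u⟫ + f x θ)
    -- `l` is continuous, bounded, and Lipschitz in `θ` uniformly over `x`
    (h_cont : ContinuousOn (fun p : E × X => condLoss κ loss p.2 p.1) (𝒟 ×ˢ Set.univ))
    (D : ℝ) (h_bdd : ∀ θ ∈ 𝒟, ∀ x, |condLoss κ loss x θ| ≤ D)
    (L : ℝ) (h_lip : ∀ θ ∈ 𝒟, ∀ θ' ∈ 𝒟, ∀ x,
      |condLoss κ loss x θ - condLoss κ loss x θ'| ≤ L * ‖θ - θ'‖)
    -- the optimal parameter and the split proportion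
    (θstar : E) (hθstar : θstar ∈ 𝒟) (hθstar_min : IsMinOn (risk Pte κ loss) 𝒟 θstar)
    (ρ : ℝ) (hρ : ρ ∈ Set.Icc (0 : ℝ) 1) :
    ∃ (M : ℝ → ℝ) (M' : ℝ), ∀ ntr nte : ℕ, 1 ≤ splitSize ρ ntr → 1 ≤ nte →
      -- KMM weights, computed from the first part of the training covariates and the test sample
      ∀ βhat : (Fin (splitSize ρ ntr) → X) → (Fin nte → X) → Fin (splitSize ρ ntr) → ℝ,
      Measurable (fun p : (Fin (splitSize ρ ntr) → X) × (Fin nte → X) => βhat p.1 p.2) →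
      (∀ x x', IsKMMWeights H B x x' (βhat x x')) →
      -- an estimate of `l`, computed from the remaining training data
      ∀ lhat : (Fin (ntr - splitSize ρ ntr) → X × 𝒴) → X → E → ℝ,
      (∀ S, ∀ θ ∈ 𝒟, ∃ u : H, ‖u‖ ≤ C ∧ ∀ x, lhat S x θ = ⟪featureMap H x, u⟫ + f x θ) →
      -- a minimizer over `𝒟` of the robust reweighted empirical risk
      ∀ θhat : (Fin ntr → X × 𝒴) × (Fin nte → X) → E,
      (∀ᵐ S ∂(dataLaw Ptr Pte κ ntr nte), θhat S ∈ 𝒟 ∧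
        IsMinOn
          (robustRisk loss (lhat (lastPart (splitSize ρ ntr) S.1))
            (βhat (fun j => (firstPart (splitSize_le hρ ntr) S.1 j).1) S.2)
            (firstPart (splitSize_le hρ ntr) S.1) S.2)
          𝒟 (θhat S)) →
      -- the rate, with high probability
      (∀ δ ∈ Set.Ioo (0 : ℝ) 1,
        dataLaw Ptr Pte κ ntr nte
          {S | ¬ risk Pte κ loss (θhat S) ≤ risk Pte κ loss θstar
              + M δ * ((ntr : ℝ) ^ (-(1 / 2) : ℝ) + (nte : ℝ) ^ (-(1 / 2) : ℝ))}
          ≤ ENNReal.ofReal δ) ∧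
      -- the rate in expectation over the data (the excess risk is nonnegative)
      ∫⁻ S, ENNReal.ofReal (risk Pte κ loss (θhat S) - risk Pte κ loss θstar)
          ∂(dataLaw Ptr Pte κ ntr nte)
        ≤ ENNReal.ofReal
            (M' * ((ntr : ℝ) ^ (-(1 / 2) : ℝ) + (nte : ℝ) ^ (-(1 / 2) : ℝ))) := by
  have hlm : ∀ θ ∈ 𝒟, Measurable fun x => condLoss κ loss x θ := fun θ hθ =>
    (h_cont.comp_continuous (f := fun x : X => (θ, x)) (by fun_prop)
      fun x => ⟨hθ, Set.mem_univ x⟩).measurable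
  have hli : ∀ θ ∈ 𝒟, Integrable (fun x => condLoss κ loss x θ) Pte := fun θ hθ =>
    Integrable.of_bound (hlm θ hθ).aestronglyMeasurable D (ae_of_all _ (h_bdd θ hθ))
  obtain ⟨x₀⟩ : Nonempty X := nonempty_of_isProbabilityMeasure Pte
  have hR : 0 ≤ R := (norm_nonneg _).trans (hΦ x₀)
  have hC : 0 ≤ C := by
    obtain ⟨Λ, hΛ, -⟩ := h_loss θstar hθstar
    exact (norm_nonneg _).trans hΛ
  have hΥi : ∀ x, Integrable (fun y => Υ (x, y)) (κ x) := fun x =>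
    Integrable.of_bound (hΥ_meas.comp_measurable measurable_prodMk_left).aestronglyMeasurable R
      (ae_of_all _ fun y => hΥ _)
  let ξ : X × 𝒴 → F := fun z => Υ z - ∫ y, Υ (z.1, y) ∂(κ z.1)
  have hξm : StronglyMeasurable ξ :=
    hΥ_meas.sub (hΥ_meas.integral_kernel_prod_right'.comp_measurable measurable_fst)
  have hξb : ∀ z, ‖ξ z‖ ≤ 2 * R := fun z => by
    have h1 : ‖∫ y, Υ (z.1, y) ∂(κ z.1)‖ ≤ R :=
      (norm_integral_le_of_norm_le_const (ae_of_all _ fun y => hΥ (z.1, y))).trans_eq (by simp)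
    exact (norm_sub_le _ _).trans (by linarith [hΥ z])
  have hξ0 : ∀ x, ∫ y, ξ (x, y) ∂(κ x) = 0 := fun x => by
    simp only [ξ]
    rw [integral_sub (hΥi x) (integrable_const _)]
    simp
  have hξΛ : ∀ θ (Λ : F), (∀ x y, loss x y θ = ⟪Υ (x, y), Λ⟫ + f x θ) →
      ∀ z, ⟪ξ z, Λ⟫ = loss z.1 z.2 θ - condLoss κ loss z.1 θ := by
    intro θ Λ hΛ z
    have h1 : condLoss κ loss z.1 θ = ⟪∫ y, Υ (z.1, y) ∂(κ z.1), Λ⟫ + f z.1 θ := by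
      simp only [condLoss, hΛ]
      rw [integral_add ((hΥi _).inner_const _) (integrable_const _), real_inner_comm,
        ← integral_inner (hΥi _)]
      simp [real_inner_comm]
    rw [h1, hΛ, inner_sub_left]
    ring
  have hrisk : ∀ θ ∈ 𝒟, risk Pte κ loss θ = ∫ x, condLoss κ loss x θ ∂Pte := by
    intro θ hθ
    refine risk_eq_integral_condLoss ?_
    obtain ⟨Λ, -, hΛ⟩ := h_loss θ hθ
    -- No measurability of `f` is available; writing the loss through `ξ` and the conditional loss,
    -- which is continuous in `x`, eliminates `f`.
    have h1 : (fun z : X × 𝒴 => loss z.1 z.2 θ)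
        = fun z => ⟪ξ z, Λ⟫ + condLoss κ loss z.1 θ := by
      ext z
      rw [hξΛ θ Λ hΛ]
      ring
    rw [h1]
    refine Integrable.add ?_ ?_
    · exact (Integrable.of_bound hξm.aestronglyMeasurable _ (ae_of_all _ hξb)).inner_const Λ
    · exact Integrable.of_bound ((hlm θ hθ).comp measurable_fst).aestronglyMeasurable D
        (ae_of_all _ fun z => h_bdd θ hθ z.1)
  obtain ⟨c, hc, hemp⟩ := exists_empirical_process_bound h𝒟 hθstar Pte hlm hli h_lip
  -- The first group collects the terms of order `m ^ (-1/2)`, with `√(2 / ρ)` converting `m` to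
  -- `ntr`; the second collects the test-sample terms. For `ρ = 0` no `ntr` satisfies the size
  -- condition, so the value is irrelevant.
  let M' : ℝ := (2 * C * (B * (2 * R)) + 4 * C * (B * R + R)) * √(2 / ρ) + (4 * C * (2 * R) + c)
  refine ⟨fun δ => M' / δ, M', ?_⟩
  intro ntr nte hm hn βhat hβm hβ lhat hlhat θhat hθhat
  have hB0 : 0 ≤ B := by
    have := (hβ (fun _ => x₀) fun _ => x₀).1 ⟨0, hm⟩
    exact this.1.trans this.2
  have hρ0 : 0 < ρ := by
    refine hρ.1.lt_of_ne fun h => ?_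
    simp [splitSize, ← h] at hm
  have hnte : (nte : ℝ) ^ (-(1 / 2) : ℝ) = 1 / √nte := by
    rw [Real.rpow_neg (Nat.cast_nonneg _), ← Real.sqrt_eq_rpow, one_div]
  have hsplit := inv_sqrt_splitSize_le hρ0 hm
  have hle := splitSize_le hρ ntr
  let μ : H := ∫ x, featureMap H x ∂Pte
  have hμ : ‖μ‖ ≤ R :=
    (norm_integral_le_of_norm_le_const (ae_of_all _ hΦ)).trans_eq (by simp)
  obtain ⟨b, hbm, hbB, hbμ⟩ := exists_bounded_density h_ac hB0 hB (featureMap H : X → H)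
  obtain ⟨hNi, hNle⟩ := integral_norm_weighted_noise_le (P := Ptr) (κ := κ)
    (τ := Measure.pi fun _ : Fin nte => Pte) hle hβm hB0 (fun x x' => (hβ x x').1) hξm
    (by positivity) hξb hξ0
  have hbΦ : ∀ x, ‖b x • featureMap H x‖ ≤ B * R := fun x => by
    rw [norm_smul, Real.norm_of_nonneg (hbB x).1]
    exact mul_le_mul (hbB x).2 (hΦ x) (norm_nonneg _) hB0
  have hbΦm : StronglyMeasurable fun x => b x • featureMap H x := hbm.stronglyMeasurable.smul hΦ_meas
  -- The weighted feature is viewed as a function of the labelled pair, to match the law of the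
  -- training sample; its mean under `Ptr` is `μ` by the change of measure.
  have hηm : StronglyMeasurable fun z : X × 𝒴 => b z.1 • featureMap H z.1 - μ :=
    (hbΦm.comp_measurable measurable_fst).sub stronglyMeasurable_const
  have hηb : ∀ z : X × 𝒴, ‖b z.1 • featureMap H z.1 - μ‖ ≤ B * R + R := fun z =>
    (norm_sub_le _ _).trans (add_le_add (hbΦ _) hμ)
  have hη0 : ∫ z : X × 𝒴, (b z.1 • featureMap H z.1 - μ) ∂(Ptr ⊗ₘ κ) = 0 := by
    rw [Measure.integral_compProd (Integrable.of_bound hηm.aestronglyMeasurable (B * R + R)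
      (ae_of_all _ hηb))]
    simp only [integral_const, probReal_univ, one_smul]
    rw [integral_sub (Integrable.of_bound hbΦm.aestronglyMeasurable _ (ae_of_all _ hbΦ))
      (integrable_const _), hbμ]
    simp [μ]
  obtain ⟨hAi, hAle⟩ := integral_norm_mean_iid_le hle hηm hηb hη0
  obtain ⟨hTi, hTle⟩ := integral_norm_mean_iid_le (ν := Pte) (le_refl nte)
    (η := fun x => featureMap H x - μ) (K := 2 * R) (hΦ_meas.sub stronglyMeasurable_const)
    (fun x => (norm_sub_le _ _).trans (by linarith [hΦ x]))
    (by
      rw [integral_sub (Integrable.of_bound hΦ_meas.aestronglyMeasurable _ (ae_of_all _ hΦ))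
        (integrable_const _)]
      simp [μ])
  obtain ⟨G, hGi, hGb, hGle⟩ := hemp nte hn
  have hG0 : ∀ S, 0 ≤ G S := fun S => (abs_nonneg _).trans (hGb θstar hθstar S)
  let noise : (Fin ntr → X × 𝒴) × (Fin nte → X) → ℝ := fun S =>
    ‖(1 / (splitSize ρ ntr : ℝ)) • ∑ j, βhat (fun i => (firstPart hle S.1 i).1) S.2 j • ξ (firstPart hle S.1 j)‖
  let train : (Fin ntr → X × 𝒴) → ℝ := fun S =>
    ‖(1 / (splitSize ρ ntr : ℝ)) • ∑ j, (b (firstPart hle S j).1 • featureMap H (firstPart hle S j).1 - μ)‖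
  let test : (Fin nte → X) → ℝ := fun S =>
    ‖(1 / (nte : ℝ)) • ∑ i, (featureMap H (firstPart (le_refl nte) S i) - μ)‖
  -- Twice the uniform deviation of the robust risk, incurred at `θhat S` and at `θstar`, plus the
  -- empirical-process increment between them.
  let bound : (Fin ntr → X × 𝒴) × (Fin nte → X) → ℝ := fun S =>
    2 * C * noise S + 4 * C * train S.1 + (4 * C * test S.2 + G S.2)
  have hi1 : Integrable (fun S => 2 * C * noise S) (dataLaw Ptr Pte κ ntr nte) :=
    hNi.const_mul (2 * C)
  have hi2 : Integrable (fun S => 4 * C * train S.1) (dataLaw Ptr Pte κ ntr nte) :=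
    (hAi.comp_fst _).const_mul (4 * C)
  have hi3 : Integrable (fun S => 4 * C * test S.2) (dataLaw Ptr Pte κ ntr nte) :=
    (hTi.comp_snd _).const_mul (4 * C)
  have hi4 : Integrable (fun S => G S.2) (dataLaw Ptr Pte κ ntr nte) := hGi.comp_snd _
  have hi12 : Integrable (fun S => 2 * C * noise S + 4 * C * train S.1)
      (dataLaw Ptr Pte κ ntr nte) := hi1.add hi2
  have hi34 : Integrable (fun S => 4 * C * test S.2 + G S.2) (dataLaw Ptr Pte κ ntr nte) :=
    hi3.add hi4
  have hbound_le : ∫ S, bound S ∂(dataLaw Ptr Pte κ ntr nte)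
      ≤ M' * ((ntr : ℝ) ^ (-(1 / 2) : ℝ) + (nte : ℝ) ^ (-(1 / 2) : ℝ)) := by
    have e1 : ∫ S, bound S ∂(dataLaw Ptr Pte κ ntr nte)
        = 2 * C * ∫ S, noise S ∂(dataLaw Ptr Pte κ ntr nte)
          + 4 * C * ∫ S, train S.1 ∂(dataLaw Ptr Pte κ ntr nte)
          + (4 * C * ∫ S, test S.2 ∂(dataLaw Ptr Pte κ ntr nte)
            + ∫ S, G S.2 ∂(dataLaw Ptr Pte κ ntr nte)) := by
      simp only [bound]
      rw [integral_add hi12 hi34, integral_add hi1 hi2, integral_add hi3 hi4,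
        integral_const_mul, integral_const_mul, integral_const_mul]
    have e2 : ∫ S, train S.1 ∂(dataLaw Ptr Pte κ ntr nte) ≤ (B * R + R) / √(splitSize ρ ntr) := by
      rw [dataLaw, integral_fun_fst (f := train), probReal_univ, one_smul]
      exact hAle
    have e3 : ∫ S, test S.2 ∂(dataLaw Ptr Pte κ ntr nte) ≤ 2 * R / √nte := by
      rw [dataLaw, integral_fun_snd (f := test), probReal_univ, one_smul]
      exact hTle
    have e4 : ∫ S, G S.2 ∂(dataLaw Ptr Pte κ ntr nte) ≤ c / √nte := by
      rw [dataLaw, integral_fun_snd (f := G), probReal_univ, one_smul]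
      exact hGle
    have e5 : ∫ S, noise S ∂(dataLaw Ptr Pte κ ntr nte) ≤ B * (2 * R) / √(splitSize ρ ntr) := hNle
    rw [e1, hnte]
    have hK1 : 0 ≤ 2 * C * (B * (2 * R)) + 4 * C * (B * R + R) := by positivity
    calc _ ≤ 2 * C * (B * (2 * R) / √(splitSize ρ ntr)) + 4 * C * ((B * R + R) / √(splitSize ρ ntr))
          + (4 * C * (2 * R / √nte) + c / √nte) := by gcongr
      _ = (2 * C * (B * (2 * R)) + 4 * C * (B * R + R)) * (1 / √(splitSize ρ ntr))
          + (4 * C * (2 * R) + c) * (1 / √nte) := by ring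
      _ ≤ (2 * C * (B * (2 * R)) + 4 * C * (B * R + R)) * (√(2 / ρ) * (ntr : ℝ) ^ (-(1 / 2) : ℝ))
          + (4 * C * (2 * R) + c) * (1 / √nte) := by gcongr
      _ ≤ M' * ((ntr : ℝ) ^ (-(1 / 2) : ℝ) + 1 / √nte) := by
          simp only [M']
          have p1 : 0 ≤ (2 * C * (B * (2 * R)) + 4 * C * (B * R + R)) * √(2 / ρ) * (1 / √nte) := by
            positivity
          have p2 : 0 ≤ (4 * C * (2 * R) + c) * (ntr : ℝ) ^ (-(1 / 2) : ℝ) := by positivity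
          nlinarith
  have hexcess : ∀ᵐ S ∂(dataLaw Ptr Pte κ ntr nte),
      risk Pte κ loss (θhat S) - risk Pte κ loss θstar ≤ bound S := by
    filter_upwards [hθhat] with S hS
    obtain ⟨hθ, hmin⟩ := hS
    -- The right side does not involve `θ`, so the bound applies at the data-dependent `θhat S`.
    have hdev : ∀ θ ∈ 𝒟, |robustRisk loss (lhat (lastPart (splitSize ρ ntr) S.1))
        (βhat (fun j => (firstPart hle S.1 j).1) S.2) (firstPart hle S.1) S.2 θ
          - 1 / (nte : ℝ) * ∑ i, condLoss κ loss (S.2 i) θ|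
        ≤ C * noise S + 2 * C * (train S.1 + test S.2) := by
      intro θ hθ
      obtain ⟨Λ, hΛ, hlossθ⟩ := h_loss θ hθ
      obtain ⟨u, hu, hcondθ⟩ := h_cond θ hθ
      obtain ⟨uhat, huhat, hlhatθ⟩ := hlhat (lastPart (splitSize ρ ntr) S.1) θ hθ
      refine (abs_robustRisk_sub_le hu huhat hΛ (hξΛ θ Λ hlossθ) hcondθ hlhatθ _ _ _).trans ?_
      have := (hβ (fun j => (firstPart hle S.1 j).1) S.2).norm_residual_le hm hn hbB μ
      exact add_le_add le_rfl (mul_le_mul_of_nonneg_left this (by positivity))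
    have h1 := abs_le.1 (hdev _ hθ)
    have h2 := abs_le.1 (hdev _ hθstar)
    have h3 := abs_le.1 (hGb _ hθ S.2)
    have h4 := hmin hθstar
    simp only [Set.mem_ofPred_eq] at h4
    rw [hrisk _ hθ, hrisk _ hθstar]
    simp only [bound]
    linarith [h1.1, h2.2, h3.1]
  have hM' : 0 < M' := by positivity
  obtain ⟨hprob, hexp⟩ := lintegral_le_and_measure_le_of_ae_le
    (hi12.add hi34) (fun S => by
      have := hG0 S.2
      simp only [Pi.add_apply, noise, train, test]
      positivity) hexcess (by positivity) hbound_le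
  refine ⟨fun δ hδ => ?_, hexp⟩
  convert hprob δ hδ using 4 with S
  rw [div_mul_eq_mul_div, sub_le_iff_le_add']
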